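/- For a positive integer $N$ and a set $A \subseteq \mathbb{Z}/N\mathbb{Z}$, let the Cayley sum graph $G_A$ be the graph on vertex set $\mathbb{Z}/N\mathbb{Z}$ in which two distinct vertices $i, j$ are joined if and only if $i + j \in A$. For every sufficiently large integer $N$ there exists a set $A \subseteq \mathbb{Z}/N\mathbb{Z}$ such that $G_A$ contains neither a clique nor an independent set with at least $160 \log_2 N$ vertices (equivalently, with exactly $\lceil 160 \log_2 N\rceil$ vertices). -/

import Mathlib

/-- The Cayley sum graph `G_A` of a set `A` in an abelian group `Γ`: the vertex set is `Γ`, and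
two distinct vertices `i`, `j` are joined exactly when `i + j ∈ A`. -/
def cayleySumGraph {Γ : Type*} [AddCommGroup Γ] (A : Set Γ) : SimpleGraph Γ where
  Adj i j := i ≠ j ∧ i + j ∈ A
  symm := ⟨fun i j h => ⟨h.1.symm, by rw [add_comm]; exact h.2⟩⟩
  loopless := ⟨fun _ h => h.1 rfl⟩

/-! A clique or independent set `X` of the graph forces every sum of two distinct elements of `X`
into `A`, respectively out of `A`. For uniformly random `A` a fixed set `E` is swallowed or missed
with probability `2 * 2^(-#E)`. So it is enough to find a family of "certificates" `E` of total
weight `∑ 2^(-#E) < 1/2` such that the restricted sumset of every `k`-set contains one of them. A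
union bound over all `k`-sets is too costly, since many have small sumsets; the point is that small
sumsets come from few sets.

Rank measures this. A tuple satisfying enough additive relations to have corank `D` has about `N^D`
choices, up to factors independent of `N` (`card_relationCorank_eq_le`), while a weak Freiman lemma
gives `D * #X ≤ 2 * #(X + X)` (`relationCorank_mul_card_le`). As `log N` is at most `k / 100`, the
entropy `D * log N` is a small fraction of the sumset size.

Write `j` for about `log k`. If the doubling exceeds `20 * j + 20`, the restricted sumset itself is
the certificate: the remaining cost of order `j * k` is also affordable. Otherwise `X` lies in the
`{-1, 0, 1}`-span of `O(j^2)` of its elements, so a small part of `X` is cheap to specify. Take a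
small `X' ⊆ X` and add translates greedily. Either `X' + T` becomes large enough to be a
certificate, or all of `X` is trapped in a set of size about `D * k / 25`; then its subsets can be
enumerated, and the restricted sumset, of size at least `D * k / 2 - k`, pays for that. -/

/-! ### A weak Freiman lemma. -/

-- Choose one element of `X` above each `w ∈ W`. In the sum of such an element with one of `F`, the
-- value of `φ` recovers `w`, and then cancellation recovers the element of `F`; `hnew` separates
-- these sums from `X' + X'`.
open Finset Pointwise in
theorem card_add_mul_le_card_add_self {G : Type*} [AddCommGroup G] [DecidableEq G]
    (X X' F : Finset G) (φ : G → ℝ) (v : ℝ)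
    (hφ : ∀ x ∈ X, ∀ y ∈ X, ∀ z ∈ X, ∀ w ∈ X, x + y = z + w → φ x + φ y = φ z + φ w)
    (hX' : X' ⊆ X) (hF : F ⊆ X) (hv : ∀ x ∈ F, φ x = v) (W : Finset ℝ)
    (hW : W ⊆ X.image φ) (hnew : ∀ w ∈ W, ∀ a ∈ X', ∀ b ∈ X', φ a + φ b ≠ v + w) :
    #(X' + X') + #W * #F ≤ #(X + X) := by
  classical
  have hsec : ∀ w, ∃ y, w ∈ W → y ∈ X ∧ φ y = w := by
    intro w
    by_cases h : w ∈ W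
    · obtain ⟨y, hy, hyw⟩ := mem_image.1 (hW h)
      exact ⟨y, fun _ => ⟨hy, hyw⟩⟩
    · exact ⟨0, fun h' => absurd h' h⟩
  choose s hs using hsec
  have hinj : Set.InjOn (fun p : ℝ × G => s p.1 + p.2) (W ×ˢ F : Finset (ℝ × G)) := by
    rintro ⟨w, x⟩ h ⟨w', x'⟩ h' heq
    simp only [coe_product, Set.mem_prod, mem_coe] at h h' heq
    have := hφ _ (hs w h.1).1 _ (hF h.2) _ (hs w' h'.1).1 _ (hF h'.2) heq
    rw [(hs w h.1).2, (hs w' h'.1).2, hv _ h.2, hv _ h'.2] at this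
    have hww : w = w' := by linarith
    subst hww
    simpa using heq
  have hsub : (W ×ˢ F).image (fun p : ℝ × G => s p.1 + p.2) ⊆ X + X := by
    intro z hz
    obtain ⟨⟨w, x⟩, h, rfl⟩ := mem_image.1 hz
    rw [mem_product] at h
    exact add_mem_add (hs w h.1).1 (hF h.2)
  have hdisj : Disjoint (X' + X') ((W ×ˢ F).image (fun p : ℝ × G => s p.1 + p.2)) := by
    rw [disjoint_left]
    intro z hz hz'
    obtain ⟨⟨w, x⟩, h, rfl⟩ := mem_image.1 hz'
    rw [mem_product] at h
    obtain ⟨a, ha, b, hb, hab⟩ := mem_add.1 hz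
    have := hφ _ (hX' ha) _ (hX' hb) _ (hs w h.1).1 _ (hF h.2) hab
    rw [(hs w h.1).2, hv _ h.2] at this
    exact hnew w h.1 a ha b hb (by linarith)
  have := card_le_card (union_subset (add_subset_add hX' hX') hsub)
  rwa [card_union_of_disjoint hdisj, card_image_of_injOn hinj, card_product] at this

open Finset Pointwise in
theorem card_add_card_le_card_add_self {G : Type*} [AddCommGroup G] [DecidableEq G]
    (X X' : Finset G) (φ : G → ℝ) (x₀ : G)
    (hφ : ∀ x ∈ X, ∀ y ∈ X, ∀ z ∈ X, ∀ w ∈ X, x + y = z + w → φ x + φ y = φ z + φ w)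
    (hX' : X' ⊆ X) (hx₀ : x₀ ∈ X)
    (hnew : ∀ x ∈ X, ∀ a ∈ X', ∀ b ∈ X', φ a + φ b ≠ φ x₀ + φ x) :
    #(X' + X') + #X ≤ #(X + X) := by
  classical
  have hdisj : Disjoint (X' + X') (X.image (x₀ + ·)) := by
    rw [disjoint_left]
    intro z hz hz'
    obtain ⟨x, hx, rfl⟩ := mem_image.1 hz'
    obtain ⟨a, ha, b, hb, hab⟩ := mem_add.1 hz
    exact hnew x hx a ha b hb (hφ _ (hX' ha) _ (hX' hb) _ hx₀ _ hx hab)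
  have hsub : X.image (x₀ + ·) ⊆ X + X := by
    intro z hz
    obtain ⟨x, hx, rfl⟩ := mem_image.1 hz
    exact add_mem_add hx₀ hx
  have := card_le_card (union_subset (add_subset_add hX' hX') hsub)
  rwa [card_union_of_disjoint hdisj, card_image_of_injective _ (add_right_injective x₀)] at this

open Finset in
/-- Every positive finite set of reals is spanned by its elements that are not sums of two others. -/
theorem mem_span_indecomposable (P : Finset ℝ) (hP : ∀ p ∈ P, 0 < p) :
    ∀ p ∈ P, p ∈ Submodule.span ℚ
      ({p ∈ P | ∀ a ∈ P, ∀ b ∈ P, a + b ≠ p} : Set ℝ) := by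
  suffices h : ∀ n : ℕ, ∀ p ∈ P, #{q ∈ P | q < p} = n → p ∈ Submodule.span ℚ
      ({p ∈ P | ∀ a ∈ P, ∀ b ∈ P, a + b ≠ p} : Set ℝ) from fun p hp => h _ p hp rfl
  intro n
  induction n using Nat.strong_induction_on with
  | _ n ih =>
    intro p hp hn
    by_cases hd : ∀ a ∈ P, ∀ b ∈ P, a + b ≠ p
    · exact Submodule.subset_span ⟨hp, hd⟩
    · push Not at hd
      obtain ⟨a, ha, b, hb, rfl⟩ := hd
      have ha0 := hP a ha
      have hb0 := hP b hb
      have key : ∀ c ∈ P, c < a + b → #{q ∈ P | q < c} < n := by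
        intro c hc hlt
        rw [← hn]
        apply card_lt_card
        rw [ssubset_iff_of_subset
          (fun q hq => by simp only [mem_filter] at hq ⊢; exact ⟨hq.1, hq.2.trans hlt⟩)]
        exact ⟨c, by simp [hc, hlt], by simp⟩
      exact Submodule.add_mem _ (ih _ (key a ha (by linarith)) a ha rfl)
        (ih _ (key b hb (by linarith)) b hb rfl)

-- Induction by removing the fibre `F` over the maximal value `v`. Sums of `F` with points above `v`
-- and above the indecomposable differences below `v` cannot come from lower points, and those
-- values span, so at least `D * #F` sums are lost. That suffices unless the dimension drops as
-- well; then the whole translate `x₀ + X` is also new, which pays for the drop.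
open Finset Pointwise Module in
theorem finrank_span_mul_card_le_real {G : Type*} [AddCommGroup G] [DecidableEq G] (φ : G → ℝ)
    (X : Finset G)
    (hφ : ∀ x ∈ X, ∀ y ∈ X, ∀ z ∈ X, ∀ w ∈ X, x + y = z + w → φ x + φ y = φ z + φ w) :
    finrank ℚ (Submodule.span ℚ (φ '' X)) * #X ≤ 2 * #(X + X) := by
  classical
  induction hn : #X using Nat.strong_induction_on generalizing X with
  | _ n ih =>
  rcases X.eq_empty_or_nonempty with rfl | hne
  · simp at hn; simp [← hn]
  obtain ⟨x₀, hx₀, hmax⟩ := exists_max_image X φ hne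
  set v := φ x₀ with hv
  set X' := {x ∈ X | φ x < v} with hX'
  set F := {x ∈ X | φ x = v} with hF
  have hX'X : X' ⊆ X := filter_subset _ _
  have hFX : F ⊆ X := filter_subset _ _
  have hxF : x₀ ∈ F := by simp [hF, hx₀, hv]
  have hsplit : #X = #X' + #F := by
    rw [← card_union_of_disjoint]
    · congr 1
      ext x
      simp only [hX', hF, mem_union, mem_filter]
      constructor
      · intro hx
        rcases (hmax x hx).lt_or_eq with h | h
        · exact Or.inl ⟨hx, h⟩
        · exact Or.inr ⟨hx, h⟩
      · rintro (h | h) <;> exact h.1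
    · rw [disjoint_left]
      intro x h h'
      simp only [hX', hF, mem_filter] at h h'
      linarith [h.2, h'.2]
  have hFpos : 0 < #F := card_pos.2 ⟨x₀, hxF⟩
  have hlt : #X' < n := by omega
  have IH := ih _ hlt X' (fun x hx y hy z hz w hw =>
    hφ x (hX'X hx) y (hX'X hy) z (hX'X hz) w (hX'X hw)) rfl
  set D := finrank ℚ (Submodule.span ℚ (φ '' X)) with hD
  set D' := finrank ℚ (Submodule.span ℚ (φ '' X')) with hD'
  have himg : φ '' (X : Set G) ⊆ insert v (φ '' X') := by
    rintro _ ⟨x, hx, rfl⟩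
    rcases (hmax x hx).lt_or_eq with h | h
    · exact Set.mem_insert_of_mem _ ⟨x, by simpa [hX'] using ⟨hx, h⟩, rfl⟩
    · exact Set.mem_insert_iff.2 (Or.inl h)
  -- the sums of the top fibre with the indecomposable differences are new
  set P := X'.image (fun x => v - φ x) with hP
  set I := {p ∈ P | ∀ a ∈ P, ∀ b ∈ P, a + b ≠ p} with hI
  set W := insert v (I.image (v - ·)) with hW
  have hWX : W ⊆ X.image φ := by
    intro w hw
    rcases mem_insert.1 hw with rfl | hw
    · exact mem_image_of_mem _ hx₀
    · obtain ⟨p, hp, rfl⟩ := mem_image.1 hw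
      obtain ⟨x, hx, rfl⟩ := mem_image.1 (mem_filter.1 hp).1
      simpa using ⟨x, hX'X hx, rfl⟩
  have hnew : ∀ w ∈ W, ∀ a ∈ X', ∀ b ∈ X', φ a + φ b ≠ v + w := by
    intro w hw a ha b hb h
    rcases mem_insert.1 hw with rfl | hw
    · have h1 := (mem_filter.1 ha).2
      have h2 := (mem_filter.1 hb).2
      linarith
    · obtain ⟨p, hp, rfl⟩ := mem_image.1 hw
      exact (mem_filter.1 hp).2 _ (mem_image_of_mem _ ha) _ (mem_image_of_mem _ hb)
        (by linarith)
  have h1 := card_add_mul_le_card_add_self X X' F φ v hφ hX'X hFX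
    (fun x hx => (mem_filter.1 hx).2) W hWX hnew
  have hspan : Submodule.span ℚ (φ '' (X : Set G)) ≤ Submodule.span ℚ (W : Set ℝ) := by
    rw [Submodule.span_le]
    refine himg.trans ?_
    rw [Set.insert_subset_iff]
    have hvW : v ∈ Submodule.span ℚ (W : Set ℝ) := Submodule.subset_span (by simp [hW])
    refine ⟨hvW, ?_⟩
    rintro _ ⟨x, hx, rfl⟩
    have hpos : ∀ p ∈ P, 0 < p := by
      intro p hp
      obtain ⟨y, hy, rfl⟩ := mem_image.1 hp
      have := (mem_filter.1 hy).2
      linarith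
    have h2 := mem_span_indecomposable P hpos (v - φ x) (mem_image_of_mem _ hx)
    have h3 : Submodule.span ℚ ({p ∈ P | ∀ a ∈ P, ∀ b ∈ P, a + b ≠ p} : Set ℝ) ≤
        Submodule.span ℚ (W : Set ℝ) := by
      rw [Submodule.span_le]
      intro p hp
      have : v - p ∈ Submodule.span ℚ (W : Set ℝ) := by
        apply Submodule.subset_span
        have : p ∈ I := mem_filter.2 hp
        simp only [hW, coe_insert, coe_image]
        exact Set.mem_insert_of_mem _ ⟨p, this, rfl⟩
      have := Submodule.sub_mem _ hvW this
      simpa using this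
    have := Submodule.sub_mem _ hvW (h3 h2)
    simpa using this
  have hDW : D ≤ #W :=
    (Submodule.finrank_mono hspan).trans (finrank_span_finset_le_card W)
  have h2 : #(X' + X') + D * #F ≤ #(X + X) :=
    (Nat.add_le_add_left (Nat.mul_le_mul_right _ hDW) _).trans h1
  have hfin : FiniteDimensional ℚ (Submodule.span ℚ (φ '' (X' : Set G))) :=
    FiniteDimensional.span_of_finite ℚ (X'.finite_toSet.image φ)
  rw [← hn, hsplit]
  -- If `v` is in the span of the lower values, the dimension does not drop and `h2` with the
  -- induction hypothesis is enough. Otherwise it drops by at most one, and the two lower bounds for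
  -- `#(X + X)` are added.
  by_cases hmem : v ∈ Submodule.span ℚ (φ '' (X' : Set G))
  · have hDD : D ≤ D' := by
      apply Submodule.finrank_mono
      rw [Submodule.span_le]
      refine himg.trans (Set.insert_subset hmem Submodule.subset_span)
    have := Nat.mul_le_mul_right (#X') hDD
    nlinarith
  · have hDD : D ≤ D' + 1 := by
      have : Submodule.span ℚ (φ '' (X : Set G)) ≤
          Submodule.span ℚ (φ '' (X' : Set G)) ⊔ Submodule.span ℚ {v} := by
        rw [← Submodule.span_union, Set.union_singleton]
        exact Submodule.span_mono himg
      have h3 := Submodule.finrank_mono this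
      have h4 := Submodule.finrank_add_le_finrank_add_finrank
        (Submodule.span ℚ (φ '' (X' : Set G))) (Submodule.span ℚ {v})
      have h5 : finrank ℚ (Submodule.span ℚ {v}) ≤ 1 := by
        simpa using finrank_span_le_card (R := ℚ) ({v} : Set ℝ)
      omega
    -- A coincidence with a lower `φ x` would express `v` through lower values; one with `φ x = v`
    -- contradicts maximality.
    have h3 := card_add_card_le_card_add_self X X' φ x₀ hφ hX'X hx₀ (by
      intro x hx a ha b hb h
      have ha' : φ a ∈ Submodule.span ℚ (φ '' (X' : Set G)) :=
        Submodule.subset_span ⟨a, ha, rfl⟩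
      have hb' : φ b ∈ Submodule.span ℚ (φ '' (X' : Set G)) :=
        Submodule.subset_span ⟨b, hb, rfl⟩
      rcases (hmax x hx).lt_or_eq with h' | h'
      · have hx' : φ x ∈ Submodule.span ℚ (φ '' (X' : Set G)) :=
          Submodule.subset_span ⟨x, by simpa [hX'] using ⟨hx, h'⟩, rfl⟩
        apply hmem
        have : v = φ a + φ b - φ x := by linarith
        rw [this]
        exact Submodule.sub_mem _ (Submodule.add_mem _ ha' hb') hx'
      · have h1 := (mem_filter.1 ha).2
        have h2 := (mem_filter.1 hb).2
        linarith)
    have := Nat.mul_le_mul_right (#X') hDD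
    nlinarith

open Finset Pointwise Module in
/-- A weak form of Freiman's lemma that allows a Freiman homomorphism with large fibres. -/
theorem finrank_span_mul_card_le {G V : Type*} [AddCommGroup G] [DecidableEq G]
    [AddCommGroup V] [Module ℚ V] [FiniteDimensional ℚ V] (φ : G → V) (X : Finset G)
    (hφ : ∀ x ∈ X, ∀ y ∈ X, ∀ z ∈ X, ∀ w ∈ X, x + y = z + w → φ x + φ y = φ z + φ w) :
    finrank ℚ (Submodule.span ℚ (φ '' X)) * #X ≤ 2 * #(X + X) := by
  -- A `ℚ`-linear embedding into `ℝ` supplies the total order that the induction on the top fibre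
  -- needs.
  have : Cardinal.lift.{0} (Module.rank ℚ V) ≤ Cardinal.lift (Module.rank ℚ ℝ) := by
    rw [Real.rank_rat_real]
    have : Module.rank ℚ V < Cardinal.aleph0 := rank_lt_aleph0 ℚ V
    simpa using this.le.trans Cardinal.aleph0_le_continuum
  obtain ⟨f, hf⟩ : ∃ f : V →ₗ[ℚ] ℝ, Function.Injective f :=
    lift_rank_le_iff_exists_linearMap.1 this
  have h := finrank_span_mul_card_le_real (f ∘ φ) X (by
    intro x hx y hy z hz w hw h
    simp only [Function.comp, ← map_add, hφ x hx y hy z hz w hw h])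
  rwa [Set.image_comp, ← Submodule.map_span,
    ← (Submodule.equivMapOfInjective f hf _).finrank_eq] at h

/-! ### Counting solutions of integer linear systems modulo `N`. -/

open Matrix in
theorem index_range_mulVecLin_eq_natAbs_det {n : ℕ} (A : Matrix (Fin n) (Fin n) ℤ)
    (hA : A.det ≠ 0) : (LinearMap.range A.mulVecLin).toAddSubgroup.index = A.det.natAbs := by
  have hinj : Function.Injective A.mulVecLin := by
    rw [← LinearMap.ker_eq_bot, LinearMap.ker_eq_bot']
    intro x h
    exact eq_zero_of_mulVec_eq_zero hA h
  have h := Submodule.natAbs_det_equiv (LinearMap.range A.mulVecLin)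
    (LinearEquiv.ofInjective A.mulVecLin hinj)
  rw [AddSubgroup.index]
  refine h.symm.trans ?_
  rw [← LinearMap.det_toLin']
  rfl

-- `N` need not be prime, so rank over a field is not available. The solutions form a coset of the
-- kernel or are absent; in a finite group the kernel has the size of the cokernel, which is a
-- quotient of `ℤ^n / A ℤ^n`, of order `|det A|`.
open Matrix in
theorem card_mulVec_eq_le_natAbs_det {n N : ℕ} [NeZero N] (A : Matrix (Fin n) (Fin n) ℤ)
    (hA : A.det ≠ 0) (b : Fin n → ZMod N) :
    (Finset.univ.filter fun x : Fin n → ZMod N => ∀ i, ∑ j, A i j • x j = b i).card ≤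
      A.det.natAbs := by
  classical
  let f : (Fin n → ZMod N) →+ (Fin n → ZMod N) :=
    { toFun := fun x i => ∑ j, A i j • x j
      map_zero' := by ext; simp
      map_add' := fun x y => by ext; simp [Finset.sum_add_distrib] }
  let π : (Fin n → ℤ) →+ (Fin n → ZMod N) :=
    { toFun := fun x i => x i
      map_zero' := by ext; simp
      map_add' := fun x y => by ext; simp }
  have hπ : Function.Surjective π := fun y =>
    ⟨fun i => (ZMod.intCast_surjective (y i)).choose,
      funext fun i => (ZMod.intCast_surjective (y i)).choose_spec⟩
  have hker : Nat.card f.ker = f.range.index := by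
    have h1 := f.ker.card_mul_index
    rw [AddSubgroup.index_ker, ← f.range.card_mul_index, mul_comm] at h1
    exact Nat.eq_of_mul_eq_mul_left Nat.card_pos h1
  have hle : (LinearMap.range A.mulVecLin).toAddSubgroup ≤ f.range.comap π := by
    rintro _ ⟨x, rfl⟩
    refine ⟨π x, ?_⟩
    ext i
    simp [f, π, mulVec, dotProduct]
  have hdvd := AddSubgroup.index_dvd_of_le hle
  rw [AddSubgroup.index_comap_of_surjective _ hπ, index_range_mulVecLin_eq_natAbs_det A hA,
    ← hker] at hdvd
  refine le_trans ?_ (Nat.le_of_dvd (Int.natAbs_pos.2 hA) hdvd)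
  rcases Finset.eq_empty_or_nonempty
    (Finset.univ.filter fun x : Fin n → ZMod N => ∀ i, ∑ j, A i j • x j = b i) with h0 | ⟨x₀, hx₀⟩
  · rw [h0]; simp
  · rw [Nat.card_eq_fintype_card, ← Finset.card_univ]
    simp only [Finset.mem_filter, Finset.mem_univ, true_and] at hx₀
    refine Finset.card_le_card_of_injOn
      (fun x => if h : x - x₀ ∈ f.ker then ⟨x - x₀, h⟩ else 0) (by simp) ?_
    have hmem : ∀ x : Fin n → ZMod N, (∀ i, ∑ j, A i j • x j = b i) → x - x₀ ∈ f.ker := by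
      intro x hx
      rw [AddMonoidHom.mem_ker, map_sub, sub_eq_zero]
      ext i
      exact (hx i).trans (hx₀ i).symm
    intro x hx y hy h
    simp only [Finset.coe_filter, Finset.mem_univ, true_and, Set.mem_ofPred_eq] at hx hy
    simp only [dif_pos (hmem x hx), dif_pos (hmem y hy), Subtype.mk.injEq] at h
    exact sub_left_injective h

/-! ### Certificates and the random set. -/

-- The union bound as a count of subsets: each `E` excludes a proportion `2^(-#E)` of all `A` for
-- containment and, by complementation, the same for disjointness.
open Finset in
theorem exists_finset_avoiding {G : Type*} [Fintype G] [DecidableEq G]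
    (C : Finset (Finset G)) (hC : ∑ E ∈ C, ((1 : ℝ) / 2) ^ #E < 1 / 2) :
    ∃ A : Finset G, ∀ E ∈ C, ¬ E ⊆ A ∧ ¬ Disjoint E A := by
  by_contra! hno
  have hcount : ∀ E : Finset G, (#{A : Finset G | E ⊆ A} : ℝ) =
      2 ^ Fintype.card G * ((1 : ℝ) / 2) ^ #E := by
    intro E
    have h1 : ({A : Finset G | E ⊆ A} : Finset (Finset G)) = Finset.Icc E univ := by
      ext A; simp
    rw [h1, card_Icc_finset (subset_univ E), card_univ]
    have := card_le_univ E
    push_cast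
    rw [pow_sub₀ _ two_ne_zero this]
    simp
  have hcount' : ∀ E : Finset G, (#{A : Finset G | Disjoint E A} : ℝ) =
      2 ^ Fintype.card G * ((1 : ℝ) / 2) ^ #E := by
    intro E
    rw [← hcount]
    congr 1
    refine card_bij (fun A _ => Aᶜ) ?_ ?_ ?_
    · intro A hA
      simp only [mem_filter, mem_univ, true_and] at hA ⊢
      exact le_compl_iff_disjoint_right.2 hA
    · intro A _ B _ h
      exact compl_injective h
    · intro A hA
      simp only [mem_filter, mem_univ, true_and] at hA ⊢
      exact ⟨Aᶜ, le_compl_iff_disjoint_right.1 (by simpa using hA), by simp⟩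
  have hcover : (univ : Finset (Finset G)) ⊆
      C.biUnion (fun E => ({A : Finset G | E ⊆ A} : Finset _) ∪
        ({A : Finset G | Disjoint E A} : Finset _)) := by
    intro A _
    obtain ⟨E, hE, h⟩ := hno A
    simp only [mem_biUnion, mem_union, mem_filter, mem_univ, true_and]
    refine ⟨E, hE, ?_⟩
    by_cases hs : E ⊆ A
    · exact Or.inl hs
    · exact Or.inr (h hs)
  have h1 := (card_le_card hcover).trans (card_biUnion_le.trans
    (sum_le_sum fun E _ => card_union_le _ _))
  have h2 : ((2 : ℝ) ^ Fintype.card G) ≤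
      ∑ E ∈ C, (2 * (2 ^ Fintype.card G * ((1 : ℝ) / 2) ^ #E)) := by
    have := (Nat.cast_le (α := ℝ)).2 h1
    push_cast [hcount, hcount'] at this
    simpa [two_mul] using this
  rw [← mul_sum, ← mul_sum] at h2
  have hpos : (0 : ℝ) < 2 ^ Fintype.card G := by positivity
  nlinarith

open Finset in
theorem sum_half_pow_card_le {G : Type*} (C : Finset (Finset G)) (c b : ℕ)
    (hcard : #C ≤ 2 ^ c) (hE : ∀ E ∈ C, c + b ≤ #E) :
    ∑ E ∈ C, ((1 : ℝ) / 2) ^ #E ≤ (1 / 2) ^ b := by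
  calc ∑ E ∈ C, ((1 : ℝ) / 2) ^ #E ≤ ∑ E ∈ C, ((1 : ℝ) / 2) ^ (c + b) :=
        sum_le_sum fun E h => pow_le_pow_of_le_one (by norm_num) (by norm_num) (hE E h)
    _ = #C * (1 / 2) ^ (c + b) := by simp
    _ ≤ 2 ^ c * (1 / 2) ^ (c + b) := by gcongr; exact_mod_cast hcard
    _ = (1 / 2) ^ b := by rw [pow_add, ← mul_assoc, ← mul_pow]; norm_num

/-! ### Greedy growth by translates. -/

open Finset Pointwise in
/-- Greedy growth of `X' + T` by translates: either it grows by half a translate at each step, or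
every further translate of `X'` lies mostly in it. -/
theorem exists_growing_or_saturated {G : Type*} [AddCommGroup G] [DecidableEq G]
    (Z X' : Finset G) (hZ : Z.Nonempty) (ρ : ℕ) (hX' : #X' = 2 * ρ) (τ : ℕ) :
    ∃ f : Fin τ → G, (∀ i, f i ∈ Z) ∧
      (τ * ρ ≤ #(X' + univ.image f) ∨
        ∀ x ∈ Z, ρ < #((X'.image (· + x)) ∩ (X' + univ.image f))) := by
  induction τ with
  | zero => exact ⟨Fin.elim0, fun i => i.elim0, Or.inl (by simp)⟩
  | succ τ ih =>
    obtain ⟨f, hf, h⟩ := ih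
    have himg : ∀ z, univ.image (Fin.cons z f : Fin (τ + 1) → G) = insert z (univ.image f) := by
      intro z
      ext y
      simp [Fin.exists_fin_succ, eq_comm]
    -- Saturation persists when the tuple is lengthened, so any `z` will do; without saturation some
    -- translate adds at least `2 * ρ - ρ` new points.
    by_cases hsat : ∀ x ∈ Z, ρ < #((X'.image (· + x)) ∩ (X' + univ.image f))
    · obtain ⟨z, hz⟩ := hZ
      refine ⟨Fin.cons z f, fun i => Fin.cases hz hf i, Or.inr fun x hx => ?_⟩
      refine (hsat x hx).trans_le (card_le_card (inter_subset_inter_left ?_))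
      rw [himg]
      exact add_subset_add_left (subset_insert _ _)
    · have h1 := h.resolve_right hsat
      push Not at hsat
      obtain ⟨z, hz, hzle⟩ := hsat
      refine ⟨Fin.cons z f, fun i => Fin.cases hz hf i, Or.inl ?_⟩
      have h2 : #(X'.image (· + z)) = 2 * ρ := by
        rw [card_image_of_injective _ (add_left_injective z), hX']
      have h3 := card_union_add_card_inter (X'.image (· + z)) (X' + univ.image f)
      have h4 : X'.image (· + z) ∪ (X' + univ.image f) ⊆
          X' + univ.image (Fin.cons z f : Fin (τ + 1) → G) := by
        rw [himg]
        refine union_subset ?_ (add_subset_add_left (subset_insert _ _))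
        intro y hy
        obtain ⟨x, hx, rfl⟩ := mem_image.1 hy
        exact add_mem_add hx (mem_insert_self _ _)
      have h5 := card_le_card h4
      nlinarith

-- Double count pairs `(y, s)` with `s ∈ S` and `s - y ∈ X'`: such a pair is determined by `(s - y,
-- s)`.
open Finset Pointwise in
theorem card_mul_le_of_lt_card_inter {G : Type*} [AddCommGroup G] [DecidableEq G]
    (X' S Y : Finset G) (ρ : ℕ)
    (hY : ∀ y ∈ Y, ρ < #((X'.image (· + y)) ∩ S)) : #Y * ρ ≤ #X' * #S := by
  have h1 : #Y * ρ ≤ ∑ y ∈ Y, #((X'.image (· + y)) ∩ S) := by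
    rw [← smul_eq_mul]
    exact card_nsmul_le_sum _ _ _ fun y hy => (hY y hy).le
  refine h1.trans ?_
  rw [← card_sigma, ← card_product]
  refine card_le_card_of_injOn (fun p => (p.2 - p.1, p.2)) ?_ ?_
  · rintro ⟨y, s⟩ h
    simp only [coe_sigma, Set.mem_sigma_iff, mem_coe, mem_inter, mem_image] at h
    obtain ⟨-, ⟨x, hx, rfl⟩, hs⟩ := h
    simp [hx, hs]
  · rintro ⟨y, s⟩ _ ⟨y', s'⟩ _ h
    simp only [Prod.mk.injEq] at h
    obtain ⟨h1, rfl⟩ := h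
    simpa using h1

/-! ### Rank of a tuple modulo its relations, and the number of tuples of given rank. -/

/-- The rational span of the relations from `R` that the tuple `t` satisfies. -/
def relationSpan {n : ℕ} {G : Type*} [AddCommGroup G] (R : Finset (Fin n → ℤ)) (t : Fin n → G) :
    Submodule ℚ (Fin n → ℚ) :=
  Submodule.span ℚ ((fun (r : Fin n → ℤ) i => (r i : ℚ)) '' {r | r ∈ R ∧ ∑ i, r i • t i = 0})

/-- The rank of the tuple `t` modulo those relations from `R` that it satisfies. -/
noncomputable def relationCorank {n : ℕ} {G : Type*} [AddCommGroup G] (R : Finset (Fin n → ℤ))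
    (t : Fin n → G) : ℕ :=
  Module.finrank ℚ ((Fin n → ℚ) ⧸ relationSpan R t)

theorem relationCorank_le {n : ℕ} {G : Type*} [AddCommGroup G] (R : Finset (Fin n → ℤ))
    (t : Fin n → G) : relationCorank R t ≤ n := by
  simpa [relationCorank] using Submodule.finrank_quotient_le (relationSpan R t)

theorem relationSpan_add_relationCorank {n : ℕ} {G : Type*} [AddCommGroup G]
    (R : Finset (Fin n → ℤ)) (t : Fin n → G) :
    relationCorank R t + Module.finrank ℚ (relationSpan R t) = n := by
  simpa [relationCorank] using Submodule.finrank_quotient_add_finrank (relationSpan R t)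

-- Sending `x` to the class of its coefficient vector is a Freiman homomorphism on `X`, because `R`
-- contains the relations arising from additive quadruples. By `hunit` each `t i` goes to the class
-- of a unit vector, so the image spans the quotient and the weak Freiman lemma applies in full
-- dimension.
open Finset Pointwise in
theorem relationCorank_mul_card_le {n : ℕ} {G : Type*} [AddCommGroup G] [DecidableEq G]
    (R : Finset (Fin n → ℤ)) (t : Fin n → G) (X : Finset G) (a : G → Fin n → ℤ)
    (ha : ∀ x ∈ X, ∑ i, a x i • t i = x) (ht : ∀ i, t i ∈ X)
    (hquad : ∀ x ∈ X, ∀ y ∈ X, ∀ z ∈ X, ∀ w ∈ X, x + y = z + w → a x + a y - a z - a w ∈ R)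
    (hunit : ∀ i, Pi.single i 1 - a (t i) ∈ R) :
    relationCorank R t * #X ≤ 2 * #(X + X) := by
  classical
  let c : (Fin n → ℤ) → Fin n → ℚ := fun r i => (r i : ℚ)
  have hmem : ∀ r ∈ R, ∑ i, r i • t i = 0 → c r ∈ relationSpan R t := fun r hr h =>
    Submodule.subset_span ⟨r, ⟨hr, h⟩, rfl⟩
  let φ : G → (Fin n → ℚ) ⧸ relationSpan R t := fun x => (relationSpan R t).mkQ (c (a x))
  have h := finrank_span_mul_card_le φ X (by
    intro x hx y hy z hz w hw hxy
    rw [← sub_eq_zero]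
    simp only [φ, ← map_add, ← map_sub]
    rw [Submodule.mkQ_apply, Submodule.Quotient.mk_eq_zero]
    convert hmem _ (hquad x hx y hy z hz w hw hxy) ?_ using 1
    · ext i; simp [c]; ring
    · simp only [Pi.add_apply, Pi.sub_apply, sub_smul, add_smul, sum_add_distrib, sum_sub_distrib,
        ha x hx, ha y hy, ha z hz, ha w hw]
      rw [hxy]; abel)
  have htop : Submodule.span ℚ (φ '' X) = ⊤ := by
    rw [eq_top_iff, ← Submodule.range_mkQ (relationSpan R t), LinearMap.range_eq_map,
      ← (Pi.basisFun ℚ (Fin n)).span_eq, Submodule.map_span, Submodule.span_le]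
    rintro _ ⟨_, ⟨i, rfl⟩, rfl⟩
    refine Submodule.subset_span ⟨t i, ht i, ?_⟩
    simp only [φ]
    symm
    rw [← sub_eq_zero, ← map_sub, Submodule.mkQ_apply, Submodule.Quotient.mk_eq_zero]
    convert hmem _ (hunit i) ?_ using 1
    · ext j; by_cases hj : j = i
      · subst hj; simp [c]
      · simp [c, hj]
    · simp only [Pi.sub_apply, sub_smul, sum_sub_distrib, ha _ (ht i)]
      simp [Pi.single_apply, ite_smul]
  rw [htop, finrank_top] at h
  exact h

-- A basis of `relationSpan R t` made of satisfied relations is completed by unit vectors to a basis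
-- of `ℚ^n`; the added rows, as many as the corank, are indexed by `I`.
open Finset in
theorem exists_matrix_of_relationCorank {n : ℕ} {G : Type*} [AddCommGroup G]
    (R : Finset (Fin n → ℤ)) (t : Fin n → G) :
    ∃ (A : Fin n → Fin n → ℤ) (I : Finset (Fin n)), #I = relationCorank R t ∧
      (∀ i, A i ∈ R ∪ univ.image (fun j => (Pi.single j 1 : Fin n → ℤ))) ∧
      (Matrix.of A).det ≠ 0 ∧ ∀ i ∉ I, ∑ j, A i j • t j = 0 := by
  classical
  let c : (Fin n → ℤ) → Fin n → ℚ := fun r i => (r i : ℚ)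
  set s := c '' {r | r ∈ R ∧ ∑ i, r i • t i = 0} with hs
  obtain ⟨b, hbs, hspan, hli⟩ := exists_linearIndependent ℚ s
  have hli' : LinearIndepOn ℚ id b := hli
  set u := s ∪ Set.range (Pi.basisFun ℚ (Fin n)) with hu
  have hbu : b ⊆ u := hbs.trans Set.subset_union_left
  set b' := hli'.extend hbu with hb'
  have hb'u : b' ⊆ u := hli'.extend_subset hbu
  have hbb' : b ⊆ b' := hli'.subset_extend hbu
  have hli2 : LinearIndependent ℚ (Subtype.val : b' → Fin n → ℚ) :=
    hli'.linearIndepOn_extend hbu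
  have htop : ⊤ ≤ Submodule.span ℚ (Set.range (Subtype.val : b' → Fin n → ℚ)) := by
    rw [Subtype.range_coe, hb', hli'.span_extend_eq_span hbu, hu,
      ← (Pi.basisFun ℚ (Fin n)).span_eq]
    exact Submodule.span_mono Set.subset_union_right
  let e : Fin n ≃ b' := (Pi.basisFun ℚ (Fin n)).indexEquiv (Module.Basis.mk hli2 htop)
  have hlift : ∀ i : Fin n, ∃ r : Fin n → ℤ, c r = (e i).1 ∧
      r ∈ R ∪ univ.image (fun j => (Pi.single j 1 : Fin n → ℤ)) ∧
      ((e i).1 ∈ b → ∑ j, r j • t j = 0) := by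
    intro i
    by_cases hi : (e i).1 ∈ b
    · obtain ⟨r, ⟨hr, hr0⟩, hre⟩ := hbs hi
      exact ⟨r, hre, mem_union_left _ hr, fun _ => hr0⟩
    · rcases hb'u (e i).2 with ⟨r, ⟨hr, hr0⟩, hre⟩ | ⟨j, hj⟩
      · exact ⟨r, hre, mem_union_left _ hr, fun _ => hr0⟩
      · refine ⟨Pi.single j 1, ?_, mem_union_right _ (mem_image_of_mem _ (mem_univ j)),
          fun h => absurd h hi⟩
        rw [← hj]
        ext l
        by_cases hl : l = j
        · subst hl; simp [c]
        · simp [c, hl]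
  choose A hA1 hA2 hA3 using hlift
  refine ⟨A, univ.filter fun i => (e i).1 ∉ b, ?_, hA2, ?_, ?_⟩
  · have h1 : #(univ.filter fun i => (e i).1 ∈ b) = Module.finrank ℚ (relationSpan R t) := by
      have hfin : Set.Finite b := (Set.toFinite b').subset hbb'
      have := hfin.fintype
      have h2 : Module.finrank ℚ (relationSpan R t) = b.toFinset.card := by
        rw [← finrank_span_set_eq_card hli']
        unfold relationSpan
        rw [hspan]
      rw [h2]
      refine card_bij (fun i _ => (e i).1) (by simp) ?_ ?_
      · intro i _ j _ h
        exact e.injective (Subtype.ext h)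
      · intro v hv
        have hv' : v ∈ b := by simpa using hv
        exact ⟨e.symm ⟨v, hbb' hv'⟩, by simpa using hv', by simp⟩
    have h2 := card_filter_add_card_filter_not (s := (univ : Finset (Fin n)))
      (fun i => (e i).1 ∈ b)
    have h3 := relationSpan_add_relationCorank R t
    simp only [card_univ, Fintype.card_fin] at h2
    omega
  · have h1 : IsUnit ((Matrix.of A).map (Int.castRingHom ℚ)) := by
      rw [← Matrix.linearIndependent_rows_iff_isUnit]
      have : ((Matrix.of A).map (Int.castRingHom ℚ)).row = fun i => (e i).1 := by
        ext i j
        rw [← hA1 i]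
        rfl
      rw [this]
      exact hli2.comp e e.injective
    intro h0
    rw [Matrix.isUnit_iff_isUnit_det] at h1
    have : ((Matrix.of A).map (Int.castRingHom ℚ)).det = 0 := by
      have := (Int.castRingHom ℚ).map_det (Matrix.of A)
      rw [h0] at this
      simpa using this.symm
    rw [this] at h1
    simp at h1
  · intro i hi
    exact hA3 i (by simpa using hi)

-- The values of the rows in `I` are free, giving `N ^ #I` right-hand sides; each has at most `|det
-- A| ≤ n! * 4^n` solutions.
open Finset in
theorem card_filter_det_ne_zero_le {n N : ℕ} [NeZero N] (A : Fin n → Fin n → ℤ)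
    (hA : ∀ i j, |A i j| ≤ 4) (I : Finset (Fin n)) :
    #{t : Fin n → ZMod N | (Matrix.of A).det ≠ 0 ∧ ∀ i ∉ I, ∑ j, A i j • t j = 0} ≤
      N ^ #I * (n.factorial * 4 ^ n) := by
  classical
  by_cases h0 : (Matrix.of A).det = 0
  · simp [h0]
  have hdet : (Matrix.of A).det.natAbs ≤ n.factorial * 4 ^ n := by
    have := Matrix.det_le (A := Matrix.of A) (abv := AbsoluteValue.abs) (x := (4 : ℤ))
      (fun i j => hA i j)
    simp only [AbsoluteValue.abs_apply, Fintype.card_fin, nsmul_eq_mul] at this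
    zify
    exact this
  let f : (Fin n → ZMod N) → (I → ZMod N) := fun t i => ∑ j, A i j • t j
  have h1 := card_le_mul_card_image (f := f)
    ({t : Fin n → ZMod N | (Matrix.of A).det ≠ 0 ∧ ∀ i ∉ I, ∑ j, A i j • t j = 0} : Finset _)
    (n.factorial * 4 ^ n) (by
      intro b _
      refine le_trans (le_trans (card_le_card ?_) (card_mulVec_eq_le_natAbs_det (Matrix.of A) h0
        (fun i => if h : i ∈ I then b ⟨i, h⟩ else 0))) hdet
      intro t ht
      simp only [mem_filter, mem_univ, true_and] at ht ⊢
      intro i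
      by_cases hi : i ∈ I
      · rw [dif_pos hi, ← ht.2]; rfl
      · rw [dif_neg hi]; exact ht.1.2 i hi)
  refine h1.trans ?_
  rw [mul_comm]
  gcongr
  refine (card_le_univ _).trans ?_
  simp [ZMod.card]

open Finset in
theorem card_relationCorank_eq_le {n N : ℕ} [NeZero N] (R : Finset (Fin n → ℤ))
    (hR : ∀ r ∈ R, ∀ i, |r i| ≤ 4) (D : ℕ) :
    #{t : Fin n → ZMod N | relationCorank R t = D} ≤
      (#R + n) ^ n * 2 ^ n * (N ^ D * (n.factorial * 4 ^ n)) := by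
  classical
  set U := R ∪ univ.image (fun j => (Pi.single j 1 : Fin n → ℤ)) with hU
  have hUcard : #U ≤ #R + n := by
    refine (card_union_le _ _).trans (Nat.add_le_add_left ?_ _)
    exact card_image_le.trans (by simp)
  have hU4 : ∀ r ∈ U, ∀ i, |r i| ≤ 4 := by
    intro r hr i
    rcases mem_union.1 hr with hr | hr
    · exact hR r hr i
    · obtain ⟨j, -, rfl⟩ := mem_image.1 hr
      by_cases h : i = j
      · subst h; simp
      · simp [h]
  have hsub : ({t : Fin n → ZMod N | relationCorank R t = D} : Finset _) ⊆
      ((Fintype.piFinset fun _ : Fin n => U) ×ˢ powersetCard D univ).biUnion fun p =>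
        {t : Fin n → ZMod N | (Matrix.of p.1).det ≠ 0 ∧ ∀ i ∉ p.2, ∑ j, p.1 i j • t j = 0} := by
    intro t ht
    simp only [mem_filter, mem_univ, true_and] at ht
    obtain ⟨A, I, hI, hA, hdet, h0⟩ := exists_matrix_of_relationCorank R t
    simp only [mem_biUnion, mem_product, Fintype.mem_piFinset, mem_powersetCard, mem_filter,
      mem_univ, true_and]
    exact ⟨(A, I), ⟨hA, subset_univ _, hI.trans ht⟩, hdet, h0⟩
  refine (card_le_card hsub).trans ((card_biUnion_le_card_mul _ _
    (N ^ D * (n.factorial * 4 ^ n)) ?_).trans ?_)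
  · rintro ⟨A, I⟩ h
    simp only [mem_product, Fintype.mem_piFinset, mem_powersetCard] at h
    rw [← h.2.2]
    exact card_filter_det_ne_zero_le A (fun i j => hU4 _ (h.1 i) j) I
  · gcongr
    rw [card_product, Fintype.card_piFinset_const, card_powersetCard, card_univ, Fintype.card_fin]
    gcongr
    exact Nat.choose_le_two_pow n D

/-! ### Small spanning subsets from small doubling. -/

open Finset Pointwise in
/-- A set of small doubling lies in the `{-1, 0, 1}`-span of few of its elements. -/
theorem exists_small_spanning_subset {G : Type*} [AddCommGroup G] [DecidableEq G]
    (X : Finset G) (κ m : ℕ) (hκ : 0 < κ) (hm : #X < 2 ^ m) (hX : #(X + X) ≤ κ * #X) :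
    ∃ T ⊆ X, #T ≤ (2 * κ + 1) * m ∧
      ∀ x ∈ X, ∃ a : G → SignType, ∑ t ∈ T, (a t : ℤ) • t = x := by
  classical
  rcases X.eq_empty_or_nonempty with rfl | hne
  · exact ⟨∅, by simp, by simp, by simp⟩
  -- `T` is a maximal subset of `X` with distinct subset sums. Maximality gives the spanning
  -- property, distinctness bounds its size.
  let dis : Finset G → Prop := fun T => ∀ S ⊆ T, ∀ S' ⊆ T, ∑ t ∈ S, t = ∑ t ∈ S', t → S = S'
  obtain ⟨T, hT, hTmax⟩ := exists_max_image (X.powerset.filter dis) card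
    ⟨∅, by
      simp only [mem_filter, mem_powerset, empty_subset, true_and, dis, subset_empty]
      rintro _ rfl _ rfl _; rfl⟩
  simp only [mem_filter, mem_powerset] at hT hTmax
  obtain ⟨hTX, hdis⟩ := hT
  refine ⟨T, hTX, ?_, ?_⟩
  · by_contra! hlt
    -- The `m`-subsets of `T` have distinct sums in `m • X`, which Plünnecke's inequality bounds by
    -- `κ ^ m * #X`. A larger `T` would have at least `(2 * κ) ^ m` such subsets, forcing `2 ^ m ≤
    -- #X`.
    have h1 : #(powersetCard m T) ≤ #(m • X) := by
      refine card_le_card_of_injOn (fun S => ∑ t ∈ S, t) ?_ ?_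
      · intro S hS
        have hS' := mem_powersetCard.1 hS
        show ∑ t ∈ S, t ∈ m • X
        have hS2 : #S = m := hS'.2
        rw [← hS2]
        clear hS hS2
        have hSX := hS'.1.trans hTX
        clear hS'
        induction S using Finset.induction_on with
        | empty => simp
        | insert s S hs ih =>
          rw [sum_insert hs, card_insert_of_notMem hs, add_comm s, succ_nsmul]
          exact add_mem_add (ih ((subset_insert _ _).trans hSX)) (hSX (mem_insert_self _ _))
      · intro S hS S' hS' h
        exact hdis S (mem_powersetCard.1 hS).1 S' (mem_powersetCard.1 hS').1 h
    have h2 := pluennecke_ruzsa_inequality_nsmul_add hne X m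
    have h3 : (#(X + X) / #X : ℚ≥0) ≤ κ := by
      rw [div_le_iff₀ (by exact_mod_cast hne.card_pos)]
      exact_mod_cast hX
    have h4 : #(m • X) ≤ κ ^ m * #X := by
      have : (#(m • X) : ℚ≥0) ≤ κ ^ m * #X := h2.trans (by gcongr)
      exact_mod_cast this
    rw [card_powersetCard] at h1
    have h5 := Nat.pow_sub_le_descFactorial (#T) m
    rw [Nat.descFactorial_eq_factorial_mul_choose] at h5
    have h6 : (2 * κ * m) ^ m ≤ (#T + 1 - m) ^ m := by
      apply Nat.pow_le_pow_left
      have : (2 * κ + 1) * m = 2 * κ * m + m := by ring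
      omega
    have h7 : m.factorial ≤ m ^ m := Nat.factorial_le_pow m
    have h8 : (2 * κ * m) ^ m ≤ m ^ m * (κ ^ m * #X) :=
      h6.trans (h5.trans (Nat.mul_le_mul h7 (h1.trans h4)))
    have hm0 : 0 < m := by
      rcases Nat.eq_zero_or_pos m with rfl | h
      · have := hne.card_pos; simp at hm; simp [hm] at this
      · exact h
    have h9 : (2 * κ * m) ^ m = 2 ^ m * (m ^ m * κ ^ m) := by
      rw [mul_pow, mul_pow]; ring
    have h10 : 0 < m ^ m * κ ^ m := by positivity
    have : 2 ^ m * (m ^ m * κ ^ m) ≤ #X * (m ^ m * κ ^ m) := by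
      rw [← h9]; calc _ ≤ _ := h8
        _ = _ := by ring
    have := Nat.le_of_mul_le_mul_right this h10
    omega
  · intro x hx
    by_cases hxT : x ∈ T
    · refine ⟨fun t => if t = x then 1 else 0, ?_⟩
      rw [sum_eq_single x]
      · simp
      · intro t _ ht; simp [ht]
      · exact fun h => absurd hxT h
    · have hndis : ¬ dis (insert x T) := by
        intro h
        have := hTmax _ ⟨insert_subset hx hTX, h⟩
        rw [card_insert_of_notMem hxT] at this
        omega
      simp only [dis] at hndis
      push Not at hndis
      -- A collision of subset sums of `insert x T` with `x` on exactly one side solves for `x` with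
      -- coefficients in `{-1, 0, 1}`. With `x` on both sides or on neither, it reduces to a
      -- collision inside `T`.
      have key : ∀ S S' : Finset G, S ⊆ T → S' ⊆ T → x + ∑ t ∈ S, t = ∑ t ∈ S', t →
          ∃ a : G → SignType, ∑ t ∈ T, (a t : ℤ) • t = x := by
        intro S S' hS hS' h
        refine ⟨fun t => if t ∈ S' then (if t ∈ S then 0 else 1) else (if t ∈ S then -1 else 0), ?_⟩
        have h1 : ∀ t ∈ T, (((if t ∈ S' then (if t ∈ S then 0 else 1) else
            (if t ∈ S then -1 else 0) : SignType) : ℤ)) • t =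
            (if t ∈ S' then t else 0) - (if t ∈ S then t else 0) := by
          intro t _
          split_ifs <;> simp
        rw [sum_congr rfl h1, sum_sub_distrib, ← sum_filter, ← sum_filter,
          filter_mem_eq_inter, filter_mem_eq_inter, inter_eq_right.2 hS, inter_eq_right.2 hS',
          ← h]
        abel
      obtain ⟨S, hS, S', hS', hsum, hne⟩ := hndis
      by_cases h1 : x ∈ S <;> by_cases h2 : x ∈ S'
      · exfalso
        apply hne
        have hE := hdis (S.erase x) (by rwa [← subset_insert_iff]) (S'.erase x)
          (by rwa [← subset_insert_iff]) (by
            rw [← add_sum_erase _ _ h1, ← add_sum_erase _ _ h2] at hsum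
            exact add_left_cancel hsum)
        rw [← insert_erase h1, ← insert_erase h2, hE]
      · rw [← add_sum_erase _ _ h1] at hsum
        exact key _ _ (by rwa [← subset_insert_iff])
          ((subset_insert_iff_of_notMem h2).1 hS') hsum
      · rw [← add_sum_erase _ _ h2] at hsum
        exact key _ _ (by rwa [← subset_insert_iff])
          ((subset_insert_iff_of_notMem h1).1 hS) hsum.symm
      · exfalso
        exact hne (hdis S ((subset_insert_iff_of_notMem h1).1 hS) S'
          ((subset_insert_iff_of_notMem h2).1 hS') hsum)

/-! ### Restricted sumsets and the case of large doubling. -/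

/-- The set of sums of two distinct elements of `X`. -/
def restrictedSumset {G : Type*} [AddCommGroup G] [DecidableEq G] (X : Finset G) : Finset G :=
  X.offDiag.image fun p => p.1 + p.2

open Finset in
theorem mem_restrictedSumset {G : Type*} [AddCommGroup G] [DecidableEq G] {X : Finset G} {z : G} :
    z ∈ restrictedSumset X ↔ ∃ x ∈ X, ∃ y ∈ X, x ≠ y ∧ x + y = z := by
  simp only [restrictedSumset, mem_image, mem_offDiag, Prod.exists]
  constructor
  · rintro ⟨x, y, ⟨hx, hy, hne⟩, h⟩; exact ⟨x, hx, y, hy, hne, h⟩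
  · rintro ⟨x, hx, y, hy, hne, h⟩; exact ⟨x, y, ⟨hx, hy, hne⟩, h⟩

open Finset Pointwise in
theorem card_add_self_le_card_restrictedSumset_add {G : Type*} [AddCommGroup G] [DecidableEq G]
    (X : Finset G) : #(X + X) ≤ #(restrictedSumset X) + #X := by
  have : X + X ⊆ restrictedSumset X ∪ X.image (fun x => x + x) := by
    intro z hz
    obtain ⟨x, hx, y, hy, rfl⟩ := mem_add.1 hz
    by_cases h : x = y
    · subst h
      exact mem_union_right _ (mem_image_of_mem (fun x => x + x) hx)
    · exact mem_union_left _ (mem_restrictedSumset.2 ⟨x, hx, y, hy, h, rfl⟩)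
  exact (card_le_card this).trans ((card_union_le _ _).trans
    (Nat.add_le_add_left card_image_le _))

/-- The additive quadruple relations between the coordinates of a `k`-tuple. -/
def quadrupleRelations (k : ℕ) : Finset (Fin k → ℤ) :=
  Finset.univ.image fun p : (Fin k × Fin k) × (Fin k × Fin k) =>
    Pi.single p.1.1 1 + Pi.single p.1.2 1 - Pi.single p.2.1 1 - Pi.single p.2.2 1

open Finset in
theorem card_quadrupleRelations_le (k : ℕ) : #(quadrupleRelations k) ≤ k ^ 4 := by
  refine card_image_le.trans ?_
  simp only [card_univ, Fintype.card_prod, Fintype.card_fin]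
  exact le_of_eq (by ring)

theorem abs_quadrupleRelations_le {k : ℕ} : ∀ r ∈ quadrupleRelations k, ∀ i, |r i| ≤ 4 := by
  intro r hr i
  obtain ⟨⟨⟨a, b⟩, c, d⟩, -, rfl⟩ := Finset.mem_image.1 hr
  have h : ∀ a : Fin k, 0 ≤ (Pi.single a 1 : Fin k → ℤ) i ∧ (Pi.single a 1 : Fin k → ℤ) i ≤ 1 := by
    intro a
    by_cases h : i = a
    · subst h; simp
    · simp [h]
  have := h a; have := h b; have := h c; have := h d
  simp only [Pi.add_apply, Pi.sub_apply, abs_le]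
  constructor <;> linarith

open Finset Pointwise in
theorem exists_enumeration_of_card {G : Type*} [AddCommGroup G] [DecidableEq G] {k : ℕ}
    (X : Finset G) (hX : #X = k) (hk : 0 < k) :
    ∃ t : Fin k → G, univ.image t = X ∧
      relationCorank (quadrupleRelations k) t * k ≤ 2 * #(X + X) := by
  classical
  let e : Fin k ≃ X := (X.equivFinOfCardEq hX).symm
  let t : Fin k → G := fun i => (e i).1
  have himg : univ.image t = X := by
    ext x
    simp only [mem_image, mem_univ, true_and, t]
    exact ⟨fun ⟨i, hi⟩ => hi ▸ (e i).2, fun hx => ⟨e.symm ⟨x, hx⟩, by simp⟩⟩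
  refine ⟨t, himg, ?_⟩
  let a : G → Fin k → ℤ := fun x => if h : x ∈ X then Pi.single (e.symm ⟨x, h⟩) 1 else 0
  have ha : ∀ x (h : x ∈ X), a x = Pi.single (e.symm ⟨x, h⟩) 1 := fun x h => dif_pos h
  have hat : ∀ i, a (t i) = Pi.single i 1 := by
    intro i
    rw [ha _ (e i).2]
    simp
  have := relationCorank_mul_card_le (quadrupleRelations k) t X a ?_ (fun i => (e i).2) ?_ ?_
  · rwa [hX] at this
  · intro x hx
    rw [ha x hx]
    simp [Pi.single_apply, ite_smul, t]
  · intro x hx y hy z hz w hw _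
    rw [ha x hx, ha y hy, ha z hz, ha w hw]
    exact mem_image.2 ⟨((e.symm ⟨x, hx⟩, e.symm ⟨y, hy⟩), (e.symm ⟨z, hz⟩, e.symm ⟨w, hw⟩)),
      mem_univ _, rfl⟩
  · intro i
    rw [hat, sub_self]
    exact mem_image.2 ⟨((⟨0, hk⟩, ⟨0, hk⟩), (⟨0, hk⟩, ⟨0, hk⟩)), mem_univ _, by simp⟩

open Finset Pointwise in
/-- Certificates for the sets of large doubling. -/
theorem exists_certificates_of_large_doubling {N k j ℓ : ℕ} [NeZero N] (hk : 0 < k)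
    (hkj : k < 2 ^ j) (hN : N ≤ 2 ^ ℓ) (hℓ : 100 * ℓ ≤ k) (D : ℕ) :
    ∃ C : Finset (Finset (ZMod N)), ∑ E ∈ C, ((1 : ℝ) / 2) ^ #E ≤ (1 / 2) ^ (j + 3) ∧
      ∀ X : Finset (ZMod N), #X = k → (20 * j + 20) * k < #(X + X) →
        ∀ t : Fin k → ZMod N, univ.image t = X →
        relationCorank (quadrupleRelations k) t = D → D * k ≤ 2 * #(X + X) →
        ∃ E ∈ C, E ⊆ restrictedSumset X := by
  classical
  -- The exponent in the bound for the number of `k`-tuples of corank `D`, with `k`, `k!` and `N`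
  -- replaced by powers of two.
  let c := 5 * j * k + 4 * k + ℓ * D
  let C : Finset (Finset (ZMod N)) :=
    {E ∈ ({t : Fin k → ZMod N | relationCorank (quadrupleRelations k) t = D} : Finset _).image
      (fun t => restrictedSumset (univ.image t)) | c + (j + 3) ≤ #E}
  have hj : 0 < j := by
    rcases Nat.eq_zero_or_pos j with rfl | h
    · simp at hkj; omega
    · exact h
  refine ⟨C, sum_half_pow_card_le C c (j + 3) ?_ fun E hE => (mem_filter.1 hE).2, ?_⟩
  · refine (card_filter_le _ _).trans (card_image_le.trans
      ((card_relationCorank_eq_le _ abs_quadrupleRelations_le D).trans ?_))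
    have h1 : #(quadrupleRelations k) + k ≤ 2 ^ (4 * j + 1) := by
      have h := card_quadrupleRelations_le k
      have h2 : k ^ 4 ≤ (2 ^ j) ^ 4 := Nat.pow_le_pow_left hkj.le 4
      have h3 : k ≤ k ^ 4 := Nat.le_self_pow (by norm_num) k
      have h4 : 2 ^ (4 * j + 1) = (2 ^ j) ^ 4 * 2 := by rw [pow_succ, mul_comm 4 j, pow_mul]
      omega
    have h2 : k.factorial ≤ (2 ^ j) ^ k :=
      (Nat.factorial_le_pow k).trans (Nat.pow_le_pow_left hkj.le k)
    calc (#(quadrupleRelations k) + k) ^ k * 2 ^ k * (N ^ D * (k.factorial * 4 ^ k))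
        ≤ (2 ^ (4 * j + 1)) ^ k * 2 ^ k * ((2 ^ ℓ) ^ D * ((2 ^ j) ^ k * 4 ^ k)) := by gcongr
      _ = 2 ^ c := by
          rw [show (4 : ℕ) = 2 ^ 2 by norm_num]
          simp only [← pow_mul, ← pow_add, c]
          congr 1; ring
  · intro X hX hlarge t ht htD hDk
    refine ⟨restrictedSumset X, mem_filter.2 ⟨mem_image.2 ⟨t, by simpa using htD, by rw [ht]⟩, ?_⟩,
      subset_rfl⟩
    have h1 := card_add_self_le_card_restrictedSumset_add X
    rw [hX] at h1
    -- So `ℓ * D` is at most `#(X + X) / 50`; the terms in `j * k` and `k` are absorbed by the large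
    -- doubling.
    have h2 : 100 * (ℓ * D) ≤ D * k := by nlinarith
    have h3 : j ≤ j * k := Nat.le_mul_of_pos_right _ hk
    have h4 : (20 * j + 20) * k = 20 * (j * k) + 20 * k := by ring
    have h5 : 5 * j * k = 5 * (j * k) := by ring
    simp only [c, h5]
    rw [h4] at hlarge
    omega

/-! ### The case of small doubling. -/

/-- The element with coefficients `a` with respect to the tuple `t`. -/
def signCombination {n : ℕ} {G : Type*} [AddCommGroup G] (t : Fin n → G) (a : Fin n → SignType) :
    G :=
  ∑ i, (a i : ℤ) • t i

/-- The integer vectors of length `n` with entries of absolute value at most `4`. -/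
noncomputable def smallRelations (n : ℕ) : Finset (Fin n → ℤ) :=
  Fintype.piFinset fun _ => Finset.Icc (-4) 4

open Finset in
theorem card_smallRelations (n : ℕ) : #(smallRelations n) = 9 ^ n := by
  rw [smallRelations, Fintype.card_piFinset_const]
  rfl

theorem abs_smallRelations_le {n : ℕ} : ∀ r ∈ smallRelations n, ∀ i, |r i| ≤ 4 := by
  intro r hr i
  have := Fintype.mem_piFinset.1 hr i
  rw [Finset.mem_Icc] at this
  exact abs_le.2 this

open Finset in
theorem card_smallRelations_corank_le {n N ℓ : ℕ} [NeZero N] (hN : N ≤ 2 ^ ℓ) (D : ℕ) :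
    #{t : Fin n → ZMod N | relationCorank (smallRelations n) t = D} ≤
      2 ^ (5 * n ^ 2 + 3 * n + ℓ * D) := by
  refine (card_relationCorank_eq_le _ abs_smallRelations_le D).trans ?_
  have h1 : #(smallRelations n) + n ≤ 2 ^ (4 * n) := by
    rw [card_smallRelations, pow_mul]
    rcases Nat.eq_zero_or_pos n with rfl | hn
    · simp
    · have h2 : n < 7 ^ n := Nat.lt_pow_self (by norm_num)
      have h3 : 9 ^ n + 7 ^ n ≤ (9 + 7) ^ n := pow_add_pow_le (Nat.zero_le _) (Nat.zero_le _) hn.ne'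
      norm_num at h3 ⊢
      omega
  have h2 : n.factorial ≤ (2 ^ n) ^ n :=
    (Nat.factorial_le_pow n).trans (Nat.pow_le_pow_left Nat.lt_two_pow_self.le n)
  calc (#(smallRelations n) + n) ^ n * 2 ^ n * (N ^ D * (n.factorial * 4 ^ n))
      ≤ (2 ^ (4 * n)) ^ n * 2 ^ n * ((2 ^ ℓ) ^ D * ((2 ^ n) ^ n * 4 ^ n)) := by gcongr
    _ = 2 ^ (5 * n ^ 2 + 3 * n + ℓ * D) := by
        rw [show (4 : ℕ) ^ n = (2 ^ 2) ^ n by norm_num]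
        simp only [← pow_mul, ← pow_add]
        congr 1; ring

-- Sign coefficients make every additive quadruple a relation with entries in `[-4, 4]`, so
-- `smallRelations` sees all of them and the rank bound holds for the short tuple `t` in place of an
-- enumeration of `X`.
open Finset Pointwise in
theorem exists_spanning_tuple {G : Type*} [AddCommGroup G] [DecidableEq G]
    (X : Finset G) (κ m : ℕ) (hκ : 0 < κ) (hm : #X < 2 ^ m) (hX : #(X + X) ≤ κ * #X) :
    ∃ n ≤ (2 * κ + 1) * m, ∃ t : Fin n → G,
      (∀ x ∈ X, ∃ a, signCombination t a = x) ∧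
      relationCorank (smallRelations n) t * #X ≤ 2 * #(X + X) := by
  classical
  obtain ⟨T, hTX, hT, hspan⟩ := exists_small_spanning_subset X κ m hκ hm hX
  let e : Fin #T ≃ T := T.equivFin.symm
  let t : Fin #T → G := fun i => (e i).1
  have hcomb : ∀ x ∈ X, ∃ a : Fin #T → SignType, signCombination t a = x := by
    intro x hx
    obtain ⟨a, ha⟩ := hspan x hx
    refine ⟨fun i => a (t i), ?_⟩
    rw [← ha, ← sum_coe_sort T, signCombination]
    exact Equiv.sum_comp e fun s : T => (a s.1 : ℤ) • s.1
  refine ⟨#T, hT, t, hcomb, ?_⟩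
  choose! a ha using hcomb
  have hsign : ∀ s : SignType, -1 ≤ (s : ℤ) ∧ (s : ℤ) ≤ 1 := by decide
  refine relationCorank_mul_card_le _ t X (fun x i => (a x i : ℤ)) (fun x hx => ha x hx)
    (fun i => hTX (e i).2) ?_ ?_
  · intro x _ y _ z _ w _ _
    refine Fintype.mem_piFinset.2 fun i => mem_Icc.2 ?_
    have := hsign (a x i); have := hsign (a y i); have := hsign (a z i); have := hsign (a w i)
    simp only [Pi.add_apply, Pi.sub_apply]
    constructor <;> linarith
  · intro i
    refine Fintype.mem_piFinset.2 fun l => mem_Icc.2 ?_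
    have := hsign (a (t i) l)
    have h : 0 ≤ (Pi.single i 1 : Fin #T → ℤ) l ∧ (Pi.single i 1 : Fin #T → ℤ) l ≤ 1 := by
      by_cases h : l = i
      · subst h; simp
      · simp [h]
    simp only [Pi.sub_apply]
    constructor <;> linarith

open Finset in
theorem exists_coefficients {G : Type*} [AddCommGroup G] [DecidableEq G] {n r : ℕ}
    (t : Fin n → G) (f : Fin r → G) (hf : ∀ i, ∃ a, signCombination t a = f i) :
    ∃ α : Fin r → Fin n → SignType, univ.image (fun i => signCombination t (α i)) =
      univ.image f := by
  choose α hα using hf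
  exact ⟨α, by simp only [hα]⟩

open Finset Pointwise in
/-- The elements whose translate of `X'` lies mostly in `X' + T`, together with `X'`. -/
def saturationSet {G : Type*} [AddCommGroup G] [DecidableEq G] [Fintype G] (ρ : ℕ)
    (X' T : Finset G) : Finset G :=
  ({y | ρ < #((X'.image (· + y)) ∩ (X' + T))} : Finset G) ∪ X'

open Finset Pointwise in
theorem card_saturationSet_le {G : Type*} [AddCommGroup G] [DecidableEq G] [Fintype G] {ρ τ : ℕ}
    (hρ : 0 < ρ) (X' T : Finset G) (hX' : #X' ≤ 2 * ρ) (hT : #T ≤ τ) :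
    #(saturationSet ρ X' T) ≤ 4 * (τ * ρ) + 2 * ρ := by
  refine (card_union_le _ _).trans (Nat.add_le_add ?_ hX')
  have h1 := card_mul_le_of_lt_card_inter X' (X' + T)
    {y | ρ < #((X'.image (· + y)) ∩ (X' + T))} ρ (fun y hy => (mem_filter.1 hy).2)
  have h2 : #(X' + T) ≤ 2 * ρ * τ := card_add_le.trans (Nat.mul_le_mul hX' hT)
  have h3 : #X' * #(X' + T) ≤ 2 * ρ * (2 * ρ * τ) := Nat.mul_le_mul hX' h2
  refine Nat.le_of_mul_le_mul_right (h1.trans (h3.trans (le_of_eq ?_))) hρ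
  ring

open Finset Pointwise in
/-- Certificates for the sets of small doubling: either a sumset `X' + T` of structured small
subsets, or the restricted sumset of a set confined to a small saturation set. -/
theorem exists_certificates_of_small_doubling {N ℓ : ℕ} [NeZero N] (hN : N ≤ 2 ^ ℓ)
    (n D k ρ τ b : ℕ) (hρ : 0 < ρ) (hρk : 2 * ρ < k)
    (hgrow : 5 * n ^ 2 + 3 * n + ℓ * D + 2 * n * (2 * ρ + τ) + b ≤ τ * ρ)
    (hsat : k ≤ 4 * (τ * ρ) + 2 * ρ → ∀ s r, D * k ≤ 2 * s → s ≤ r + k →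
      5 * n ^ 2 + 3 * n + ℓ * D + 2 * n * (2 * ρ + τ) + (4 * (τ * ρ) + 2 * ρ) + b ≤ r) :
    ∃ C : Finset (Finset (ZMod N)),
      ∑ E ∈ C, ((1 : ℝ) / 2) ^ #E ≤ (1 / 2) ^ b + (1 / 2) ^ b ∧
      ∀ X : Finset (ZMod N), #X = k → ∀ t : Fin n → ZMod N,
        (∀ x ∈ X, ∃ a, signCombination t a = x) →
        relationCorank (smallRelations n) t = D → D * k ≤ 2 * #(X + X) →
        ∃ E ∈ C, E ⊆ restrictedSumset X := by
  classical
  let Ω : Finset ((Fin n → ZMod N) × (Fin (2 * ρ) → Fin n → SignType) ×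
      (Fin τ → Fin n → SignType)) :=
    ({t : Fin n → ZMod N | relationCorank (smallRelations n) t = D} : Finset _) ×ˢ univ
  let P : (Fin n → ZMod N) × (Fin (2 * ρ) → Fin n → SignType) × (Fin τ → Fin n → SignType) →
      Finset (ZMod N) := fun ω => univ.image fun i => signCombination ω.1 (ω.2.1 i)
  let Q : (Fin n → ZMod N) × (Fin (2 * ρ) → Fin n → SignType) × (Fin τ → Fin n → SignType) →
      Finset (ZMod N) := fun ω => univ.image fun i => signCombination ω.1 (ω.2.2 i)
  -- `c` is the cost in bits of `t` together with the sign coefficients of `X'` and of the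
  -- translates; `M` bounds the saturation set, so `M` more bits select `X` inside it.
  let c := 5 * n ^ 2 + 3 * n + ℓ * D + 2 * n * (2 * ρ + τ)
  let M := 4 * (τ * ρ) + 2 * ρ
  have hΩ : #Ω ≤ 2 ^ c := by
    have h1 : ∀ r, Fintype.card (Fin r → Fin n → SignType) ≤ 2 ^ (2 * n * r) := by
      intro r
      have h2 : Fintype.card SignType = 3 := rfl
      simp only [Fintype.card_fun, Fintype.card_fin, h2]
      calc (3 ^ n) ^ r ≤ (4 ^ n) ^ r := by gcongr; norm_num
        _ = 2 ^ (2 * n * r) := by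
          rw [show (4 : ℕ) = 2 ^ 2 by norm_num, ← pow_mul, ← pow_mul, mul_assoc]
    calc #Ω ≤ 2 ^ (5 * n ^ 2 + 3 * n + ℓ * D) * (2 ^ (2 * n * (2 * ρ)) * 2 ^ (2 * n * τ)) := by
          rw [card_product, card_univ, Fintype.card_prod]
          exact Nat.mul_le_mul (card_smallRelations_corank_le hN D) (Nat.mul_le_mul (h1 _) (h1 _))
      _ = 2 ^ c := by
          simp only [← pow_add, c]
          congr 1; ring
  have hPcard : ∀ ω, #(P ω) ≤ 2 * ρ := fun ω => card_image_le.trans (by simp)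
  have hQcard : ∀ ω, #(Q ω) ≤ τ := fun ω => card_image_le.trans (by simp)
  let C₁ : Finset (Finset (ZMod N)) := {E ∈ Ω.image (fun ω => P ω + Q ω) | c + b ≤ #E}
  let C₂ : Finset (Finset (ZMod N)) :=
    {E ∈ (Ω.biUnion fun ω => (saturationSet ρ (P ω) (Q ω)).powerset).image restrictedSumset |
      c + M + b ≤ #E}
  have hC₁ : ∑ E ∈ C₁, ((1 : ℝ) / 2) ^ #E ≤ (1 / 2) ^ b :=
    sum_half_pow_card_le C₁ c b ((card_filter_le _ _).trans (card_image_le.trans hΩ))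
      fun E hE => (mem_filter.1 hE).2
  have hC₂ : ∑ E ∈ C₂, ((1 : ℝ) / 2) ^ #E ≤ (1 / 2) ^ b := by
    refine sum_half_pow_card_le C₂ (c + M) b ((card_filter_le _ _).trans (card_image_le.trans
      ((card_biUnion_le_card_mul _ _ (2 ^ M) fun ω _ => ?_).trans ?_)))
      fun E hE => (mem_filter.1 hE).2
    · rw [card_powerset]
      exact Nat.pow_le_pow_right (by norm_num)
        (card_saturationSet_le hρ _ _ (hPcard ω) (hQcard ω))
    · rw [pow_add _ c M]
      exact Nat.mul_le_mul_right _ hΩ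
  refine ⟨C₁ ∪ C₂, ?_, ?_⟩
  · have h1 := sum_union_inter (s₁ := C₁) (s₂ := C₂) (f := fun E => ((1 : ℝ) / 2) ^ #E)
    have h2 : 0 ≤ ∑ E ∈ C₁ ∩ C₂, ((1 : ℝ) / 2) ^ #E := sum_nonneg fun _ _ => by positivity
    linarith
  · intro X hX t hspan htD hDk
    obtain ⟨X', hX'X, hX'⟩ := exists_subset_card_eq (s := X) (n := 2 * ρ) (by omega)
    have hZ : (X \ X').Nonempty := by
      rw [← card_pos, card_sdiff_of_subset hX'X]
      omega
    obtain ⟨f, hf, hor⟩ := exists_growing_or_saturated (X \ X') X' hZ ρ hX' τ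
    have hfX : ∀ i, f i ∈ X := fun i => (mem_sdiff.1 (hf i)).1
    let e : Fin (2 * ρ) ≃ X' := (X'.equivFinOfCardEq hX').symm
    have he : univ.image (fun i => (e i).1) = X' := by
      ext x
      simp only [mem_image, mem_univ, true_and]
      exact ⟨fun ⟨i, hi⟩ => hi ▸ (e i).2, fun hx => ⟨e.symm ⟨x, hx⟩, by simp⟩⟩
    obtain ⟨α, hα⟩ := exists_coefficients t (fun i => (e i).1)
      (fun i => hspan _ (hX'X (e i).2))
    obtain ⟨β, hβ⟩ := exists_coefficients t f (fun i => hspan _ (hfX i))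
    rw [he] at hα
    have hω : (t, α, β) ∈ Ω := by simpa [Ω] using htD
    have hP : P (t, α, β) = X' := hα
    have hQ : Q (t, α, β) = univ.image f := hβ
    rcases hor with hbig | hsaturated
    · refine ⟨X' + univ.image f, mem_union_left _ (mem_filter.2
        ⟨mem_image.2 ⟨_, hω, by rw [hP, hQ]⟩, hgrow.trans hbig⟩), ?_⟩
      intro z hz
      obtain ⟨x, hx, y, hy, rfl⟩ := mem_add.1 hz
      obtain ⟨i, -, rfl⟩ := mem_image.1 hy
      -- The translates are taken from `X \ X'`, so every sum in `X' + T` has distinct summands.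
      refine mem_restrictedSumset.2 ⟨x, hX'X hx, f i, hfX i, ?_, rfl⟩
      rintro rfl
      exact (mem_sdiff.1 (hf i)).2 hx
    · have hsub : X ⊆ saturationSet ρ (P (t, α, β)) (Q (t, α, β)) := by
        rw [hP, hQ]
        intro x hx
        by_cases hx' : x ∈ X'
        · exact mem_union_right _ hx'
        · exact mem_union_left _ (mem_filter.2 ⟨mem_univ _, hsaturated x (mem_sdiff.2 ⟨hx, hx'⟩)⟩)
      have hkM : k ≤ M := by
        rw [← hX]
        exact (card_le_card hsub).trans (card_saturationSet_le hρ _ _ (hPcard _) (hQcard _))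
      have hrs := card_add_self_le_card_restrictedSumset_add X
      rw [hX] at hrs
      exact ⟨restrictedSumset X, mem_union_right _ (mem_filter.2 ⟨mem_image.2
        ⟨X, mem_biUnion.2 ⟨_, hω, mem_powerset.2 hsub⟩, rfl⟩, hsat hkM _ _ hDk hrs⟩), subset_rfl⟩

/-! ### Choice of parameters and the union bound. -/

open Finset in
theorem sum_biUnion_le_card_mul {ι α : Type*} [DecidableEq α] (s : Finset ι)
    (C : ι → Finset α) (f : α → ℝ) (hf : ∀ a, 0 ≤ f a) (δ : ℝ)
    (hC : ∀ i ∈ s, ∑ a ∈ C i, f a ≤ δ) : ∑ a ∈ s.biUnion C, f a ≤ #s * δ := by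
  classical
  induction s using Finset.induction_on with
  | empty => simp
  | insert i s hi ih =>
    rw [biUnion_insert, card_insert_of_notMem hi]
    have h1 := sum_union_inter (s₁ := C i) (s₂ := s.biUnion C) (f := f)
    have h2 : 0 ≤ ∑ a ∈ C i ∩ s.biUnion C, f a := sum_nonneg fun a _ => hf a
    have h3 := hC i (mem_insert_self _ _)
    have h4 := ih fun i' hi' => hC i' (mem_insert_of_mem hi')
    push_cast
    linarith

/-- The numerical inequalities behind the choice of the parameters `ρ` and `τ`. -/
theorem exists_parameters {k j ℓ n D : ℕ} (hj : 0 < j) (hbig : 10 ^ 10 * j ^ 6 ≤ k)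
    (hℓ : 100 * ℓ ≤ k) (hn : n ≤ 81 * j ^ 2) (hD : D ≤ n) :
    ∃ ρ τ : ℕ, 0 < ρ ∧ 2 * ρ < k ∧
      5 * n ^ 2 + 3 * n + ℓ * D + 2 * n * (2 * ρ + τ) + (j + 3) ≤ τ * ρ ∧
      (k ≤ 4 * (τ * ρ) + 2 * ρ → ∀ s r, D * k ≤ 2 * s → s ≤ r + k →
        5 * n ^ 2 + 3 * n + ℓ * D + 2 * n * (2 * ρ + τ) + (4 * (τ * ρ) + 2 * ρ) + (j + 3) ≤
          r) := by
  have hj2 : 1 ≤ j ^ 2 := Nat.one_le_pow _ _ hj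
  have hj4 : j ^ 4 ≤ j ^ 6 := Nat.pow_le_pow_right hj (by norm_num)
  have hj26 : j ^ 2 ≤ j ^ 6 := Nat.pow_le_pow_right hj (by norm_num)
  have hj16 : j ≤ j ^ 6 := Nat.le_self_pow (by norm_num) j
  -- Small enough that describing `X'` costs at most `k / 100`, large enough that `τ` is only
  -- `O(j^4)`; then `n * τ` is `O(j^6)`, whence the hypothesis `hbig`.
  set ρ := k / (40000 * j ^ 2) with hρ
  have hρ1 : 40000 * j ^ 2 * ρ ≤ k := Nat.mul_div_le _ _
  have hρ2 : k < 40000 * j ^ 2 * (ρ + 1) := by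
    have := Nat.lt_mul_div_succ k (show 0 < 40000 * j ^ 2 by positivity)
    exact this
  have hρ0 : 0 < ρ := Nat.div_pos (by omega) (by positivity)
  have hρ3 : k ≤ 80000 * j ^ 2 * ρ := by nlinarith
  have hρ4 : 40000 * ρ ≤ k := by nlinarith
  -- The growth requirement is `ℓ * D ≤ D * k / 100` plus the four errors `e1`–`e4`, each at most `k
  -- / 100`. Hence `τ * ρ` is placed between `(D + 4) * k / 100` and `(D + 5) * k / 100`.
  set τ := (D + 4) * k / (100 * ρ) + 1 with hτ
  have hτ1 : (D + 4) * k ≤ 100 * (τ * ρ) := by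
    have := Nat.lt_mul_div_succ ((D + 4) * k) (show 0 < 100 * ρ by positivity)
    rw [← hτ] at this
    nlinarith
  have hτ2 : 100 * (τ * ρ) ≤ (D + 5) * k := by
    have := Nat.mul_div_le ((D + 4) * k) (100 * ρ)
    have h2 : 100 * (τ * ρ) = 100 * ρ * ((D + 4) * k / (100 * ρ)) + 100 * ρ := by
      rw [hτ]; ring
    nlinarith
  have hτ3 : τ ≤ 800 * (D + 5) * j ^ 2 := by
    have h1 : 100 * (τ * ρ) ≤ (D + 5) * (80000 * j ^ 2 * ρ) :=
      hτ2.trans (Nat.mul_le_mul_left _ hρ3)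
    have h2 : τ * (100 * ρ) ≤ 800 * (D + 5) * j ^ 2 * (100 * ρ) := by
      calc τ * (100 * ρ) = 100 * (τ * ρ) := by ring
        _ ≤ _ := h1
        _ = _ := by ring
    exact Nat.le_of_mul_le_mul_right h2 (by positivity)
  have hτ4 : τ ≤ 68800 * j ^ 4 := by
    have h1 : D + 5 ≤ 86 * j ^ 2 := by omega
    calc τ ≤ 800 * (86 * j ^ 2) * j ^ 2 := hτ3.trans (by gcongr)
      _ = 68800 * j ^ 4 := by ring
  have e1 : 100 * (5 * n ^ 2 + 3 * n) ≤ k := by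
    have h1 : n ^ 2 ≤ (81 * j ^ 2) ^ 2 := Nat.pow_le_pow_left hn 2
    have h2 : (81 * j ^ 2) ^ 2 = 6561 * j ^ 4 := by ring
    omega
  have e2 : 100 * (2 * n * (2 * ρ)) ≤ k := by
    calc 100 * (2 * n * (2 * ρ)) = 400 * (n * ρ) := by ring
      _ ≤ 400 * (81 * j ^ 2 * ρ) := by gcongr
      _ ≤ 40000 * j ^ 2 * ρ := by nlinarith
      _ ≤ k := hρ1
  have e3 : 100 * (2 * n * τ) ≤ k := by
    calc 100 * (2 * n * τ) = 200 * (n * τ) := by ring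
      _ ≤ 200 * (81 * j ^ 2 * (68800 * j ^ 4)) := by gcongr
      _ = 1114560000 * j ^ 6 := by ring
      _ ≤ k := by omega
  have e4 : 100 * (j + 3) ≤ k := by omega
  have e5 : 100 * (ℓ * D) ≤ D * k := by nlinarith
  have e6 : 2 * n * (2 * ρ + τ) = 2 * n * (2 * ρ) + 2 * n * τ := by ring
  have e7 : (D + 4) * k = D * k + 4 * k := by ring
  have e8 : (D + 5) * k = D * k + 5 * k := by ring
  rw [e7] at hτ1
  rw [e8] at hτ2
  have hk0 : 0 < k := by omega
  refine ⟨ρ, τ, hρ0, by omega, by rw [e6]; omega, ?_⟩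
  intro hk s r hs hr
  -- The saturation set has size at most about `(D + 5) * k / 25`, so it can hold `k` elements only
  -- if `D ≥ 20`. From there `D * k / 2 - k` exceeds the whole cost.
  have hD20 : 20 ≤ D := by
    by_contra! h
    have : D * k ≤ 19 * k := Nat.mul_le_mul_right _ (by omega)
    omega
  have : 20 * k ≤ D * k := Nat.mul_le_mul_right _ hD20
  rw [e6]
  omega

open Finset Pointwise in
theorem exists_certificates {N k j ℓ : ℕ} [NeZero N] (hbig : 10 ^ 10 * j ^ 6 ≤ k) (hj : 0 < j)
    (hkj : k < 2 ^ j) (hN : N ≤ 2 ^ ℓ) (hℓ : 100 * ℓ ≤ k) :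
    ∃ C : Finset (Finset (ZMod N)), ∑ E ∈ C, ((1 : ℝ) / 2) ^ #E < 1 / 2 ∧
      ∀ X : Finset (ZMod N), #X = k → ∃ E ∈ C, E ⊆ restrictedSumset X := by
  classical
  have hj1 : 1 ≤ j ^ 6 := Nat.one_le_pow _ _ hj
  have hk : 0 < k := by omega
  choose C₁ hC₁ hC₁X using
    exists_certificates_of_large_doubling (N := N) hk hkj hN hℓ
  have hsmall : ∀ p : ℕ × ℕ, ∃ C : Finset (Finset (ZMod N)),
      ∑ E ∈ C, ((1 : ℝ) / 2) ^ #E ≤ (1 / 2) ^ (j + 3) + (1 / 2) ^ (j + 3) ∧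
      (p.1 ≤ 81 * j ^ 2 → ∀ X : Finset (ZMod N), #X = k → ∀ t : Fin p.1 → ZMod N,
        (∀ x ∈ X, ∃ a, signCombination t a = x) →
        relationCorank (smallRelations p.1) t = p.2 → p.2 * k ≤ 2 * #(X + X) →
        ∃ E ∈ C, E ⊆ restrictedSumset X) := by
    rintro ⟨n, D⟩
    by_cases h : n ≤ 81 * j ^ 2 ∧ D ≤ n
    · obtain ⟨ρ, τ, hρ, hρk, hgrow, hsat⟩ := exists_parameters hj hbig hℓ h.1 h.2
      obtain ⟨C, h1, h2⟩ :=
        exists_certificates_of_small_doubling (N := N) hN n D k ρ τ (j + 3) hρ hρk hgrow hsat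
      exact ⟨C, h1, fun _ => h2⟩
    -- Pairs with `D > n` are not ranks of any tuple, and `n` out of range is never used; the empty
    -- family serves as default.
    · refine ⟨∅, by simp only [sum_empty]; positivity, ?_⟩
      intro hn X _ t _ htD _
      exact absurd ⟨hn, htD.symm.le.trans (relationCorank_le _ t)⟩ h
  choose C₂ hC₂ hC₂X using hsmall
  let I := range (81 * j ^ 2 + 1) ×ˢ range (81 * j ^ 2 + 1)
  have hI : #I ≤ 2 ^ j := by
    have h1 : #I = (81 * j ^ 2 + 1) * (81 * j ^ 2 + 1) := by simp [I]
    have h2 : j ^ 2 ≤ j ^ 6 := Nat.pow_le_pow_right hj (by norm_num)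
    have h3 : j ^ 4 ≤ j ^ 6 := Nat.pow_le_pow_right hj (by norm_num)
    have h4 : (81 * j ^ 2 + 1) * (81 * j ^ 2 + 1) = 6561 * j ^ 4 + 162 * j ^ 2 + 1 := by ring
    omega
  -- There are at most `2 ^ j` values of `D` in the large case and `2 ^ j` pairs `(n, D)` in the
  -- small one, so the total weight is at most `1/8 + 2/8 < 1/2`.
  have hpow : (2 : ℝ) ^ j * (1 / 2) ^ (j + 3) = 1 / 8 := by
    rw [pow_add, ← mul_assoc, ← mul_pow]; norm_num
  have hpos : (0 : ℝ) < (1 / 2) ^ (j + 3) := by positivity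
  refine ⟨(range (k + 1)).biUnion C₁ ∪ I.biUnion C₂, ?_, ?_⟩
  · have hf : ∀ E : Finset (ZMod N), 0 ≤ ((1 : ℝ) / 2) ^ #E := fun E => by positivity
    have h1 := sum_biUnion_le_card_mul (range (k + 1)) C₁ _ hf _ fun D _ => hC₁ D
    have h2 := sum_biUnion_le_card_mul I C₂ _ hf _ fun p _ => hC₂ p
    have h3 := sum_union_inter (s₁ := (range (k + 1)).biUnion C₁) (s₂ := I.biUnion C₂)
      (f := fun E : Finset (ZMod N) => ((1 : ℝ) / 2) ^ #E)
    have h4 : 0 ≤ ∑ E ∈ (range (k + 1)).biUnion C₁ ∩ I.biUnion C₂, ((1 : ℝ) / 2) ^ #E :=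
      sum_nonneg fun E _ => hf E
    have h5 : (#(range (k + 1)) : ℝ) ≤ 2 ^ j := by
      rw [card_range]; exact_mod_cast hkj
    have h6 : (#I : ℝ) ≤ 2 ^ j := by exact_mod_cast hI
    have h7 := mul_le_mul_of_nonneg_right h5 hpos.le
    have h8 := mul_le_mul_of_nonneg_right h6 (add_pos hpos hpos).le
    rw [mul_add ((2 : ℝ) ^ j), hpow] at h8
    rw [hpow] at h7
    linarith
  · intro X hX
    by_cases hlarge : (20 * j + 20) * k < #(X + X)
    · obtain ⟨t, ht, hD⟩ := exists_enumeration_of_card X hX hk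
      obtain ⟨E, hE, hEX⟩ := hC₁X _ X hX hlarge t ht rfl hD
      refine ⟨E, mem_union_left _ (mem_biUnion.2 ⟨_, mem_range.2 ?_, hE⟩), hEX⟩
      exact Nat.lt_succ_of_le (relationCorank_le _ t)
    · obtain ⟨n, hn, t, hspan, hD⟩ := exists_spanning_tuple X (20 * j + 20) j (by omega)
        (hX ▸ hkj) (by rw [hX]; omega)
      rw [hX] at hD
      have hn' : n ≤ 81 * j ^ 2 := by
        have : (2 * (20 * j + 20) + 1) * j = 40 * j ^ 2 + 41 * j := by ring
        have : j ≤ j ^ 2 := Nat.le_self_pow (by norm_num) j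
        omega
      obtain ⟨E, hE, hEX⟩ := hC₂X (n, _) hn' X hX t hspan rfl hD
      have hD' := relationCorank_le (smallRelations n) t
      refine ⟨E, mem_union_right _ (mem_biUnion.2 ⟨(n, _), mem_product.2
        ⟨mem_range.2 (Nat.lt_succ_of_le hn'), mem_range.2 ?_⟩, hE⟩), hEX⟩
      exact Nat.lt_succ_of_le (hD'.trans hn')

theorem exists_forall_mul_log_pow_le :
    ∃ K : ℕ, ∀ k ≥ K, 10 ^ 10 * (Nat.log 2 k + 1) ^ 6 ≤ k := by
  have h := (isLittleO_pow_const_const_pow_of_one_lt (R := ℝ) 6 (one_lt_two)).bound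
    (show (0 : ℝ) < 1 / (2 * 10 ^ 10) by norm_num)
  obtain ⟨J, hJ⟩ := Filter.eventually_atTop.1 h
  refine ⟨2 ^ J, fun k hk => ?_⟩
  have hk0 : k ≠ 0 := by have := Nat.two_pow_pos J; omega
  have h1 : J ≤ Nat.log 2 k := Nat.le_log_of_pow_le one_lt_two hk
  have h2 := hJ (Nat.log 2 k + 1) (by omega)
  have h3 : (2 : ℝ) ^ Nat.log 2 k ≤ k := by exact_mod_cast Nat.pow_log_le_self 2 hk0
  rw [Real.norm_of_nonneg (by positivity), Real.norm_of_nonneg (by positivity), pow_succ (2 : ℝ)] at h2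
  have h4 : (10 ^ 10 * ((Nat.log 2 k + 1 : ℕ) : ℝ) ^ 6) ≤ k := by linarith
  exact_mod_cast h4

theorem theorem8 :
    ∃ N₀ : ℕ, ∀ N : ℕ, N₀ ≤ N → ∃ A : Set (ZMod N), ∀ X : Finset (ZMod N),
      160 * Real.logb 2 (N : ℝ) ≤ (X.card : ℝ) →
        ¬ (cayleySumGraph A).IsClique (X : Set (ZMod N)) ∧
        ¬ (cayleySumGraph A).IsIndepSet (X : Set (ZMod N)) := by
  obtain ⟨K, hK⟩ := exists_forall_mul_log_pow_le
  -- This gives `log N ≥ 2`, so `100 * ⌈log N⌉ ≤ 160 * log N` despite the rounding, and also `k ≥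
  -- K`.
  refine ⟨2 ^ (K + 2), fun N hN => ?_⟩
  have hN0 : 0 < N := lt_of_lt_of_le (by positivity) hN
  have : NeZero N := ⟨hN0.ne'⟩
  have hlog : ((K + 2 : ℕ) : ℝ) ≤ Real.logb 2 N := by
    rw [Real.le_logb_iff_rpow_le one_lt_two (by exact_mod_cast hN0), Real.rpow_natCast]
    exact_mod_cast hN
  push_cast at hlog
  set k := ⌈160 * Real.logb 2 (N : ℝ)⌉₊ with hk
  have hk1 : 160 * Real.logb 2 (N : ℝ) ≤ k := Nat.le_ceil _
  have hK0 : (0 : ℝ) ≤ K := Nat.cast_nonneg K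
  have hKk : K ≤ k := by
    have : (K : ℝ) ≤ k := by linarith
    exact_mod_cast this
  have hℓ : 100 * Nat.clog 2 N ≤ k := by
    have hN2 : 1 < N := lt_of_lt_of_le (Nat.one_lt_two_pow (by omega)) hN
    have h1 := Nat.pow_pred_clog_lt_self one_lt_two hN2
    have h2 : ((Nat.clog 2 N - 1 : ℕ) : ℝ) ≤ Real.logb 2 N := by
      rw [Real.le_logb_iff_rpow_le one_lt_two (by exact_mod_cast hN0), Real.rpow_natCast]
      exact_mod_cast h1.le
    have h3 : (Nat.clog 2 N : ℝ) ≤ ((Nat.clog 2 N - 1 : ℕ) : ℝ) + 1 := by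
      exact_mod_cast (by omega : Nat.clog 2 N ≤ Nat.clog 2 N - 1 + 1)
    have h4 : (100 * (Nat.clog 2 N : ℝ)) ≤ k := by linarith
    exact_mod_cast h4
  obtain ⟨C, hC, hCX⟩ := exists_certificates (hK k hKk) (Nat.succ_pos _)
    (Nat.lt_pow_succ_log_self one_lt_two k) (Nat.le_pow_clog one_lt_two N) hℓ
  obtain ⟨A, hA⟩ := exists_finset_avoiding C hC
  refine ⟨A, fun X hX => ?_⟩
  -- Passing to a subset of exactly `k` elements handles all larger sets.
  obtain ⟨Y, hYX, hY⟩ := Finset.exists_subset_card_eq (s := X) (n := k) (Nat.ceil_le.2 hX)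
  obtain ⟨E, hE, hEY⟩ := hCX Y hY
  constructor
  · intro hclique
    refine (hA E hE).1 fun z hz => ?_
    obtain ⟨x, hx, y, hy, hne, rfl⟩ := mem_restrictedSumset.1 (hEY hz)
    exact (hclique (hYX hx) (hYX hy) hne).2
  · intro hindep
    refine (hA E hE).2 (Finset.disjoint_left.2 fun z hz hzA => ?_)
    obtain ⟨x, hx, y, hy, hne, rfl⟩ := mem_restrictedSumset.1 (hEY hz)
    exact hindep (hYX hx) (hYX hy) hne ⟨hne, hzA⟩
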